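/- A \emph{complete simple topological graph} on $n$ vertices is a drawing of $K_n$ in the plane in which the vertices are distinct points, each edge is a non-self-intersecting arc joining its two end vertices and passing through no other vertex, any two edges have at most one point in common, and such a point is either a common end vertex or a proper crossing. A \emph{$k$-face} generated by the drawing is the bounded region enclosed by a non-self-intersecting $k$-cycle; it is \emph{odd} if $k$ is odd. The \emph{complete twisted graph} (Harborth--Mengersen) on $n$ vertices is, up to a homeomorphism of the plane, the following drawing of $K_n$. Vertex $i$ is the point $(i,0)$, $1\le i\le n$. For $i<j$ put $r_{ij}=(n+1)^2-n(i-1)-(j-1)$, so that $r_{ij}>n+1$ and $r_{ij}$ strictly decreases in the lexicographic order of $(i,j)$. The edge $(i,j)$ consists of the upper semicircle with diameter from $(i,0)$ to $(r_{ij},0)$ followed by the lower semicircle with diameter from $(r_{ij},0)$ to $(j,0)$. Proposition. Let $n\ge 0$. Every drawing of the complete twisted graph on $n$ vertices is a complete simple topological graph in which two distinct edges $(i,j)$ and $(k,\ell)$, $i<j$, $k<\ell$, meet at a point other than their endpoints if and only if $i<k<\ell<j$ or $k<i<j<\ell$, and there is a point of the plane that lies in the interior of every odd face it generates. Moreover,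 for every $\varepsilon>0$ the complete twisted graph on $n$ vertices can be drawn in the unit square $[0,1]^2$ so that every odd face it generates has area at least $1-\varepsilon$. -/

import Mathlib

open MeasureTheory

/-- The Euclidean plane, with its usual topology, bounded sets and Lebesgue measure. -/
abbrev Plane : Type := ℝ × ℝ

/-- `A` is a non-self-intersecting arc with endpoints `x` and `y`. -/
def IsArc (A : Set Plane) (x y : Plane) : Prop :=
  ∃ γ : unitInterval → Plane,
    Continuous γ ∧ Function.Injective γ ∧ Set.range γ = A ∧ γ 0 = x ∧ γ 1 = y

/-- The sets `A` and `B` cross properly at `p`: near `p`, up to a local homeomorphism that sends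
`p` to the origin, `A` is the horizontal axis and `B` is the vertical axis. -/
def ProperlyCrossAt (A B : Set Plane) (p : Plane) : Prop :=
  ∃ e : OpenPartialHomeomorph Plane Plane, p ∈ e.source ∧ e p = 0 ∧
    ∀ q ∈ e.source, (q ∈ A ↔ (e q).2 = 0) ∧ (q ∈ B ↔ (e q).1 = 0)

/-- The region inside a closed curve `γ`: the points of the complement of `γ` whose connected
component in the complement is bounded. For a Jordan curve there is, by the Jordan curve theorem,
exactly one bounded component, and this set is that component. -/
def faceInside (γ : Set Plane) : Set Plane :=
  {p | p ∉ γ ∧ Bornology.IsBounded (connectedComponentIn γᶜ p)}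

/-- The closed unit square. -/
def unitSquare : Set Plane := Set.Icc 0 1 ×ˢ Set.Icc 0 1

/-- The data of a drawing in the plane of a graph on `V`: a point for each vertex and a set for
each edge. Values of `arc` outside the edge set of `graph` play no role. -/
structure Drawing (V : Type*) where
  graph : SimpleGraph V
  point : V → Plane
  arc : Sym2 V → Set Plane

namespace Drawing

variable {V : Type*}

/-- The interior of an edge: its arc without the endpoints. -/
def arcInterior (D : Drawing V) (e : Sym2 V) : Set Plane :=
  D.arc e \ D.point '' {v | v ∈ e}

/-- Topological graphs: vertices are distinct points, edges are arcs that join their end vertices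
and pass through no other vertex, and two edges that share an interior point cross properly
there. -/
structure IsTopologicalGraph (D : Drawing V) : Prop where
  point_injective : Function.Injective D.point
  isArc : ∀ u v, D.graph.Adj u v → IsArc (D.arc s(u, v)) (D.point u) (D.point v)
  mem_of_point_mem : ∀ e ∈ D.graph.edgeSet, ∀ w, D.point w ∈ D.arc e → w ∈ e
  properlyCross : ∀ e ∈ D.graph.edgeSet, ∀ f ∈ D.graph.edgeSet, e ≠ f →
    ∀ p ∈ D.arcInterior e ∩ D.arcInterior f, ProperlyCrossAt (D.arc e) (D.arc f) p

/-- Complete simple topological graphs: any two vertices are adjacent, and any two edges have at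
most one point in common. -/
structure IsCompleteSimple (D : Drawing V) : Prop extends D.IsTopologicalGraph where
  complete : D.graph = ⊤
  simple : ∀ e ∈ D.graph.edgeSet, ∀ f ∈ D.graph.edgeSet, e ≠ f →
    (D.arc e ∩ D.arc f).Subsingleton

/-- The closed curve drawn by a closed walk. -/
def curve (D : Drawing V) {v : V} (c : D.graph.Walk v v) : Set Plane :=
  ⋃ e ∈ c.edges, D.arc e

/-- The curve drawn by a cycle does not intersect itself: any two of its edges meet only at common
end vertices. -/
def NonSelfIntersecting (D : Drawing V) {v : V} (c : D.graph.Walk v v) : Prop :=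
  ∀ e ∈ c.edges, ∀ f ∈ c.edges, e ≠ f → D.arc e ∩ D.arc f ⊆ D.point '' {w | w ∈ e ∧ w ∈ f}

/-- `F` is a `k`-face generated by `D`: the face inside a non-self-intersecting `k`-cycle. -/
def IsFace (D : Drawing V) (k : ℕ) (F : Set Plane) : Prop :=
  ∃ (v : V) (c : D.graph.Walk v v),
    c.IsCycle ∧ c.length = k ∧ D.NonSelfIntersecting c ∧ F = faceInside (D.curve c)

/-- `F` is an odd face generated by `D`. -/
def IsOddFace (D : Drawing V) (F : Set Plane) : Prop :=
  ∃ k, Odd k ∧ D.IsFace k F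

/-- All vertices and edges are drawn inside the set `S`. -/
def DrawnIn (D : Drawing V) (S : Set Plane) : Prop :=
  (∀ v, D.point v ∈ S) ∧ ∀ e ∈ D.graph.edgeSet, D.arc e ⊆ S

/-- The image of a drawing under a homeomorphism of the plane. -/
def map (D : Drawing V) (h : Plane ≃ₜ Plane) : Drawing V where
  graph := D.graph
  point v := h (D.point v)
  arc e := h '' D.arc e

/-- Two different edges `(i, j)` and `(k, l)`, with `i < j` and `k < l`, intersect outside their
endpoints if and only if their indices are nested. -/
def CrossesIffNested {n : ℕ} (D : Drawing (Fin n)) : Prop :=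
  ∀ i j k l : Fin n, i < j → k < l → s(i, j) ≠ s(k, l) →
    ((D.arcInterior s(i, j) ∩ D.arcInterior s(k, l)).Nonempty ↔
      (i < k ∧ l < j) ∨ (k < i ∧ j < l))

end Drawing

/-- The abscissa, to the right of all vertices, at which the edge `(i, j)`, `i < j`, of the twisted
drawing crosses the horizontal axis. It strictly decreases in the lexicographic order of
`(i, j)`. -/
def twistedTurn {n : ℕ} (i j : Fin n) : ℝ :=
  ((n : ℝ) + 1) ^ 2 - n * (i : ℕ) - (j : ℕ)

/-- The closed upper half of the circle with diameter from `(a, 0)` to `(b, 0)`. -/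
def upperSemicircle (a b : ℝ) : Set Plane :=
  {p | 0 ≤ p.2 ∧ (p.1 - a) * (p.1 - b) + p.2 ^ 2 = 0}

/-- The closed lower half of the circle with diameter from `(a, 0)` to `(b, 0)`. -/
def lowerSemicircle (a b : ℝ) : Set Plane :=
  {p | p.2 ≤ 0 ∧ (p.1 - a) * (p.1 - b) + p.2 ^ 2 = 0}

/-- The standard twisted drawing of the complete graph on `n` vertices. The vertices lie on the
horizontal axis at `1, …, n`. The edge `(i, j)`, `i < j`, leaves `i` upwards, passes above all
vertices to its right, crosses the axis to the right of all vertices, and returns below the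
axis to `j`. -/
def standardTwisted (n : ℕ) : Drawing (Fin n) where
  graph := ⊤
  point i := (((i : ℕ) : ℝ) + 1, 0)
  arc e :=
    upperSemicircle (((e.inf : Fin n) : ℕ) + 1) (twistedTurn e.inf e.sup) ∪
      lowerSemicircle (((e.sup : Fin n) : ℕ) + 1) (twistedTurn e.inf e.sup)

/-- `D` is a drawing of the complete twisted graph: the image of the standard twisted drawing under
a homeomorphism of the plane. -/
def IsCompleteTwisted {n : ℕ} (D : Drawing (Fin n)) : Prop :=
  ∃ h : Plane ≃ₜ Plane, D = (standardTwisted n).map h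

open Set Bornology

/-! ### Components of complements of closed curves -/

/-! The point `twistedCentre n` lies on the axis to the right of all vertices and to the left of all
turning points. Every edge therefore starts on the axis left of it, passes over it, and returns
under it to the left: one trip around. A continuous square root of the displacement from this point
changes sign along each edge (`sqrt_sign_turnArc`), so no such root exists along a closed walk of
odd length.

On the other hand, a point outside a compact set `K` does have such a root on `K`. For points far
away there is an explicit one, and its existence is locally constant off `K`, hence constant on
components (`hasSqrtOn_of_not_isBounded`). So the centre is inside every odd face
(`twistedCentre_mem_faceInside`).

The crossing pattern comes from comparing diameters: two circles over the axis are disjoint or touch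
when the diameters are nested, and meet once below the axis when they are interlaced
(`standardTwisted_inter`).

For the area, one ball around the centre misses all edges and so lies in every odd face. A
homeomorphism acting on each coordinate inflates it to almost the whole unit square while squeezing
the drawing into that square. -/

theorem isBounded_image_homeomorph {X Y : Type*} [PseudoMetricSpace X] [ProperSpace X]
    [PseudoMetricSpace Y] (e : X ≃ₜ Y) {s : Set X} (hs : IsBounded s) : IsBounded (e '' s) :=
  (hs.isCompact_closure.image e.continuous).isBounded.subset (image_mono subset_closure)

theorem isBounded_connectedComponentIn_image {X Y : Type*} [PseudoMetricSpace X] [ProperSpace X]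
    [PseudoMetricSpace Y] [ProperSpace Y] (e : X ≃ₜ Y) {K : Set X} {p : X} (hp : p ∉ K) :
    IsBounded (connectedComponentIn (e '' K)ᶜ (e p)) ↔ IsBounded (connectedComponentIn Kᶜ p) := by
  rw [← image_compl_eq e.bijective, ← e.image_connectedComponentIn hp]
  refine ⟨fun h => ?_, isBounded_image_homeomorph e⟩
  simpa [image_image] using isBounded_image_homeomorph e.symm h

theorem faceInside_image (h : Plane ≃ₜ Plane) (K : Set Plane) :
    faceInside (h '' K) = h '' faceInside K := by
  ext q
  obtain ⟨p, rfl⟩ := h.surjective q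
  rw [h.injective.mem_set_image]
  simp only [faceInside, mem_ofPred_eq, h.injective.mem_set_image]
  exact and_congr_right fun hp => isBounded_connectedComponentIn_image h hp

/-- All points of `S` have the same component in the complement of `K`. This gives openness of the
inside, and later places a whole ball in a face. -/
theorem subset_faceInside_of_isPreconnected {K S : Set Plane} (hS : IsPreconnected S)
    (hSK : S ⊆ Kᶜ) {p : Plane} (hpS : p ∈ S) (hp : p ∈ faceInside K) : S ⊆ faceInside K := by
  intro q hq
  refine ⟨hSK hq, ?_⟩
  rw [← connectedComponentIn_eq (hS.subset_connectedComponentIn hpS hSK hq)]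
  exact hp.2

theorem isOpen_faceInside {K : Set Plane} (hK : IsClosed K) : IsOpen (faceInside K) := by
  rw [isOpen_iff_mem_nhds]
  intro p hp
  have hpK : p ∈ Kᶜ := hp.1
  exact Filter.mem_of_superset
    (hK.isOpen_compl.connectedComponentIn.mem_nhds (mem_connectedComponentIn hpK))
    (subset_faceInside_of_isPreconnected isPreconnected_connectedComponentIn
      (connectedComponentIn_subset _ _) (mem_connectedComponentIn hpK) hp)

/-! ### Square roots of displacements along a compact set -/

/-- `z - q` has a continuous square root on `K`. -/
def HasSqrtOn (K : Set ℂ) (q : ℂ) : Prop :=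
  ∃ s : ℂ → ℂ, ContinuousOn s K ∧ ∀ z ∈ K, s z ^ 2 = z - q

/-- The ratio `(z - q') / (z - q)` stays at distance less than 1 from 1, hence off the branch cut,
so multiplying by its principal root corrects `s`. -/
theorem HasSqrtOn.of_near {K : Set ℂ} {q q' : ℂ} (h : HasSqrtOn K q)
    (hq : ∀ z ∈ K, ‖q' - q‖ < ‖z - q‖) : HasSqrtOn K q' := by
  obtain ⟨s, hs, hs2⟩ := h
  have hne : ∀ z ∈ K, z - q ≠ 0 := fun z hz h0 => by
    have := hq z hz
    rw [h0, norm_zero] at this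
    exact absurd this (not_lt.2 (norm_nonneg _))
  refine ⟨fun z => s z * ((z - q') / (z - q)) ^ (((2 : ℕ) : ℂ)⁻¹), ?_, ?_⟩
  · refine hs.mul (ContinuousOn.cpow ?_ continuousOn_const ?_)
    · exact ContinuousOn.div (by fun_prop) (by fun_prop) hne
    · intro z hz
      have h1 : (z - q') / (z - q) = 1 + -((q' - q) / (z - q)) := by
        field_simp [hne z hz]
        ring
      rw [h1]
      apply Complex.mem_slitPlane_of_norm_lt_one
      rw [norm_neg, norm_div, div_lt_one (norm_pos_iff.2 (hne z hz))]
      exact hq z hz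
  · intro z hz
    rw [mul_pow, Complex.cpow_nat_inv_pow _ two_ne_zero, hs2 z hz]
    field_simp [hne z hz]

/-- Factor `z - q = -q * (1 - z / q)`; the second factor has a principal root because `‖z / q‖ < 1`.
-/
theorem hasSqrtOn_of_far {K : Set ℂ} {q : ℂ} (hq : ∀ z ∈ K, ‖z‖ < ‖q‖) : HasSqrtOn K q := by
  rcases eq_or_ne q 0 with rfl | h0
  · refine ⟨fun _ => 0, continuousOn_const, fun z hz => ?_⟩
    have := hq z hz
    rw [norm_zero] at this
    exact absurd this (not_lt.2 (norm_nonneg _))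
  refine ⟨fun z => (-q) ^ (((2 : ℕ) : ℂ)⁻¹) * (1 + -(z / q)) ^ (((2 : ℕ) : ℂ)⁻¹), ?_, ?_⟩
  · refine continuousOn_const.mul (ContinuousOn.cpow (by fun_prop) continuousOn_const ?_)
    intro z hz
    apply Complex.mem_slitPlane_of_norm_lt_one
    rw [norm_neg, norm_div, div_lt_one (norm_pos_iff.2 h0)]
    exact hq z hz
  · intro z hz
    rw [mul_pow, Complex.cpow_nat_inv_pow _ two_ne_zero, Complex.cpow_nat_inv_pow _ two_ne_zero]
    field_simp
    ring

theorem exists_ball_hasSqrtOn_iff {K : Set ℂ} (hK : IsClosed K) {q : ℂ} (hq : q ∉ K) :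
    ∃ δ > 0, ∀ q' ∈ Metric.ball q δ, q' ∉ K ∧ (HasSqrtOn K q ↔ HasSqrtOn K q') := by
  obtain ⟨δ, hδ, hb⟩ := Metric.isOpen_iff.1 hK.isOpen_compl q hq
  refine ⟨δ / 2, by positivity, fun q' hq' => ⟨hb (Metric.ball_subset_ball (by linarith) hq'), ?_⟩⟩
  rw [Metric.mem_ball] at hq'
  have key : ∀ z ∈ K, δ ≤ dist z q := fun z hz => not_lt.1 fun hlt => hb hlt hz
  constructor <;> intro h <;> refine h.of_near fun z hz => ?_
  · rw [← dist_eq_norm, ← dist_eq_norm]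
    linarith [key z hz]
  · rw [← dist_eq_norm, ← dist_eq_norm, dist_comm q q']
    linarith [key z hz, dist_triangle z q' q]

theorem hasSqrtOn_of_not_isBounded {K : Set ℂ} (hK : IsCompact K) {q : ℂ} (hq : q ∉ K)
    (hC : ¬ IsBounded (connectedComponentIn Kᶜ q)) : HasSqrtOn K q := by
  obtain ⟨R, hR⟩ := hK.isBounded.exists_norm_le
  have hfar : ∃ x ∈ connectedComponentIn Kᶜ q, R < ‖x‖ := by
    by_contra! hcon
    exact hC (isBounded_iff_forall_norm_le.2 ⟨R, hcon⟩)
  obtain ⟨x, hxC, hx⟩ := hfar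
  -- With `P` equal to `True` and `False` this yields two disjoint open sets covering the component;
  -- the far point `x` lies in the first.
  have hopen : ∀ P : Prop, IsOpen {y | y ∉ K ∧ (HasSqrtOn K y ↔ P)} := by
    intro P
    rw [Metric.isOpen_iff]
    rintro y ⟨hyK, hyP⟩
    obtain ⟨δ, hδ, hb⟩ := exists_ball_hasSqrtOn_iff hK.isClosed hyK
    exact ⟨δ, hδ, fun y' hy' => ⟨(hb y' hy').1, (hb y' hy').2.symm.trans hyP⟩⟩
  have hsub := IsPreconnected.subset_left_of_subset_union (hopen True) (hopen False)
    (Set.disjoint_left.2 fun y h1 h2 => h2.2.1 (h1.2.2 trivial))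
    (s := connectedComponentIn Kᶜ q)
    (fun y hy => by
      have hyK : y ∉ K := connectedComponentIn_subset _ _ hy
      by_cases h : HasSqrtOn K y
      · exact Or.inl ⟨hyK, by simpa using h⟩
      · exact Or.inr ⟨hyK, by simpa using h⟩)
    ⟨x, hxC, connectedComponentIn_subset _ _ hxC,
      iff_of_true (hasSqrtOn_of_far fun z hz => (hR z hz).trans_lt hx) trivial⟩
    isPreconnected_connectedComponentIn
  exact (hsub (mem_connectedComponentIn hq)).2.2 trivial

/-- A point `p` of the plane that is not inside a compact set `K` has a continuous square root
of the displacement from `p` along `K`. -/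
theorem exists_sqrt_of_notMem_faceInside {K : Set Plane} (hK : IsCompact K) {p : Plane}
    (hp : p ∉ K) (hF : p ∉ faceInside K) :
    ∃ s : Plane → ℂ, ContinuousOn s K ∧ ∀ q ∈ K,
      (s q).re ^ 2 - (s q).im ^ 2 = q.1 - p.1 ∧ 2 * ((s q).re * (s q).im) = q.2 - p.2 := by
  set e : Plane ≃ₜ ℂ := Complex.equivRealProdCLM.symm.toHomeomorph with he
  have hre : ∀ q, (e q).re = q.1 := fun q => by simp [he]
  have him : ∀ q, (e q).im = q.2 := fun q => by simp [he]
  obtain ⟨s, hs, hs2⟩ := hasSqrtOn_of_not_isBounded (hK.image e.continuous) (q := e p)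
    (by rwa [e.injective.mem_set_image])
    (fun h => hF ⟨hp, (isBounded_connectedComponentIn_image e hp).1 h⟩)
  refine ⟨s ∘ e, hs.comp e.continuous.continuousOn (mapsTo_image _ _), fun q hq => ?_⟩
  have h := hs2 (e q) (mem_image_of_mem e hq)
  have h1 := congrArg Complex.re h
  have h2 := congrArg Complex.im h
  simp only [pow_two, Complex.mul_re, Complex.mul_im, Complex.sub_re, Complex.sub_im, hre, him]
    at h1 h2
  simp only [Function.comp]
  constructor <;> linarith

theorem pos_iff_pos_of_isPreconnected {X : Type*} [TopologicalSpace X] {S : Set X}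
    (hS : IsPreconnected S) {f : X → ℝ} (hf : ContinuousOn f S) (h0 : ∀ x ∈ S, f x ≠ 0) {x y : X}
    (hx : x ∈ S) (hy : y ∈ S) : 0 < f x ↔ 0 < f y := by
  have key : ∀ x ∈ S, ∀ y ∈ S, 0 < f x → 0 < f y := by
    intro x hx y hy hpos
    by_contra hneg
    obtain ⟨z, hz, hz0⟩ := hS.intermediate_value hy hx hf ⟨not_lt.1 hneg, hpos.le⟩
    exact h0 z hz hz0
  exact ⟨key x hx y hy, key y hy x hx⟩

/-! ### Semicircles -/

theorem mem_Icc_of_circle {a b : ℝ} (hab : a ≤ b) {p : Plane}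
    (hp : (p.1 - a) * (p.1 - b) + p.2 ^ 2 = 0) : a ≤ p.1 ∧ p.1 ≤ b := by
  constructor <;> by_contra! h <;> nlinarith [sq_nonneg p.2]

theorem upperSemicircle_eq_image {a b : ℝ} (hab : a ≤ b) :
    upperSemicircle a b = (fun x => (x, √((x - a) * (b - x)))) '' Icc a b := by
  ext p
  constructor
  · rintro ⟨h1, h2⟩
    refine ⟨p.1, mem_Icc_of_circle hab h2, Prod.ext rfl ?_⟩
    change √((p.1 - a) * (b - p.1)) = p.2
    rw [show (p.1 - a) * (b - p.1) = p.2 ^ 2 by linarith, Real.sqrt_sq h1]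
  · rintro ⟨x, hx, rfl⟩
    refine ⟨Real.sqrt_nonneg _, ?_⟩
    change (x - a) * (x - b) + √((x - a) * (b - x)) ^ 2 = 0
    rw [Real.sq_sqrt (mul_nonneg (sub_nonneg.2 hx.1) (sub_nonneg.2 hx.2))]
    ring

theorem lowerSemicircle_eq_image {a b : ℝ} (hab : a ≤ b) :
    lowerSemicircle a b = (fun x => (x, -√((x - a) * (b - x)))) '' Icc a b := by
  ext p
  constructor
  · rintro ⟨h1, h2⟩
    refine ⟨p.1, mem_Icc_of_circle hab h2, Prod.ext rfl ?_⟩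
    change -√((p.1 - a) * (b - p.1)) = p.2
    rw [show (p.1 - a) * (b - p.1) = (-p.2) ^ 2 by linarith, Real.sqrt_sq (by linarith), neg_neg]
  · rintro ⟨x, hx, rfl⟩
    refine ⟨neg_nonpos.2 (Real.sqrt_nonneg _), ?_⟩
    change (x - a) * (x - b) + (-√((x - a) * (b - x))) ^ 2 = 0
    rw [neg_sq, Real.sq_sqrt (mul_nonneg (sub_nonneg.2 hx.1) (sub_nonneg.2 hx.2))]
    ring

theorem isPreconnected_upperSemicircle {a b : ℝ} (hab : a ≤ b) :
    IsPreconnected (upperSemicircle a b) := by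
  rw [upperSemicircle_eq_image hab]
  exact isPreconnected_Icc.image _ (by fun_prop)

theorem isPreconnected_lowerSemicircle {a b : ℝ} (hab : a ≤ b) :
    IsPreconnected (lowerSemicircle a b) := by
  rw [lowerSemicircle_eq_image hab]
  exact isPreconnected_Icc.image _ (by fun_prop)

/-- Circles over the axis with nested diameters meet at most at a common left end. -/
theorem eq_of_circle_of_circle {a b c d : ℝ} (hac : a ≤ c) (hcd : c ≤ d) (hdb : d < b) {p : Plane}
    (h1 : (p.1 - a) * (p.1 - b) + p.2 ^ 2 = 0) (h2 : (p.1 - c) * (p.1 - d) + p.2 ^ 2 = 0) :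
    a = c ∧ p = (a, 0) := by
  obtain ⟨hc, hd⟩ := mem_Icc_of_circle hcd h2
  have hpa : p.1 = a := by
    by_contra hne
    have : a < p.1 := lt_of_le_of_ne (hac.trans hc) (Ne.symm hne)
    -- Both circles express `p.2 ^ 2` as a product of distances to the ends, and the outer product
    -- would be strictly larger.
    nlinarith [mul_pos (sub_pos.2 this) (sub_pos.2 hdb),
      mul_nonneg (sub_nonneg.2 hac) (sub_nonneg.2 hd)]
  refine ⟨by linarith, Prod.ext hpa ?_⟩
  rw [hpa] at h1
  simpa using h1

theorem circle_of_axis {a b : ℝ} {p : Plane} (hp : (p.1 - a) * (p.1 - b) + p.2 ^ 2 = 0)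
    (h0 : p.2 = 0) : p = (a, 0) ∨ p = (b, 0) := by
  rw [h0] at hp
  rcases mul_eq_zero.1 (by simpa using hp : (p.1 - a) * (p.1 - b) = 0) with h | h
  · exact Or.inl (Prod.ext (by simpa using sub_eq_zero.1 h) h0)
  · exact Or.inr (Prod.ext (by simpa using sub_eq_zero.1 h) h0)

/-- The arc that goes above the axis from `(a, 0)` to `(r, 0)` and below it back to `(b, 0)`. -/
def turnArc (a b r : ℝ) : Set Plane := upperSemicircle a r ∪ lowerSemicircle b r

/-- The points of `turnArc a b r`, for a parameter between `a` and `2 * r - b`. -/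
noncomputable def turnParam (a b r t : ℝ) : Plane :=
  (min t r + min r (2 * r - t) - r,
    √((min t r - a) * (r - min t r)) - √((min r (2 * r - t) - b) * (r - min r (2 * r - t))))

/-- On each side of `t = r` one minimum is frozen at `r` and its square root vanishes, so a single
continuous formula covers both halves. -/
theorem turnParam_of_le {a b r t : ℝ} (h : t ≤ r) :
    turnParam a b r t = (t, √((t - a) * (r - t))) := by
  simp [turnParam, min_eq_left h, min_eq_left (show r ≤ 2 * r - t by linarith)]

theorem turnParam_of_ge {a b r t : ℝ} (h : r ≤ t) :
    turnParam a b r t = (2 * r - t, -√((2 * r - t - b) * (r - (2 * r - t)))) := by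
  simp [turnParam, min_eq_right h, min_eq_right (show 2 * r - t ≤ r by linarith)]

theorem continuous_turnParam (a b r : ℝ) : Continuous (turnParam a b r) := by
  unfold turnParam
  fun_prop

theorem injOn_turnParam {a b r : ℝ} (hab : a < b) :
    InjOn (turnParam a b r) (Icc a (2 * r - b)) := by
  -- The halves could only meet at height zero with abscissa in `[b, r)`, where the upper one is
  -- strictly positive since `a < b`.
  have key : ∀ s t : ℝ, s ≤ r → r < t → t ≤ 2 * r - b → turnParam a b r s ≠ turnParam a b r t := by
    intro s t hs ht htb h
    rw [turnParam_of_le hs, turnParam_of_ge ht.le, Prod.mk.injEq] at h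
    obtain ⟨h1, h2⟩ := h
    have h3 : √((s - a) * (r - s)) = 0 :=
      le_antisymm (h2.le.trans (neg_nonpos.2 (Real.sqrt_nonneg _))) (Real.sqrt_nonneg _)
    rw [Real.sqrt_eq_zero'] at h3
    have : 0 < (s - a) * (r - s) := mul_pos (by linarith) (by linarith)
    linarith
  intro s hs t ht h
  rcases le_or_gt s r with h1 | h1 <;> rcases le_or_gt t r with h2 | h2
  · rw [turnParam_of_le h1, turnParam_of_le h2, Prod.mk.injEq] at h
    exact h.1
  · exact absurd h (key s t h1 h2 ht.2)
  · exact absurd h.symm (key t s h2 h1 hs.2)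
  · rw [turnParam_of_ge h1.le, turnParam_of_ge h2.le, Prod.mk.injEq] at h
    linarith [h.1]

theorem image_turnParam {a b r : ℝ} (har : a ≤ r) (hbr : b ≤ r) :
    turnParam a b r '' Icc a (2 * r - b) = turnArc a b r := by
  rw [turnArc, upperSemicircle_eq_image har, lowerSemicircle_eq_image hbr]
  ext p
  constructor
  · rintro ⟨t, ht, rfl⟩
    rcases le_total t r with h | h
    · exact Or.inl ⟨t, ⟨ht.1, h⟩, (turnParam_of_le h).symm⟩
    · exact Or.inr ⟨2 * r - t, ⟨by linarith [ht.2], by linarith⟩, (turnParam_of_ge h).symm⟩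
  · rintro (⟨x, hx, rfl⟩ | ⟨x, hx, rfl⟩)
    · exact ⟨x, ⟨hx.1, by linarith [hx.2]⟩, turnParam_of_le hx.2⟩
    · refine ⟨2 * r - x, ⟨by linarith [hx.2], by linarith [hx.1]⟩, ?_⟩
      rw [turnParam_of_ge (by linarith [hx.2])]
      simp

theorem isArc_turnArc {a b r : ℝ} (hab : a < b) (hbr : b ≤ r) :
    IsArc (turnArc a b r) (a, 0) (b, 0) := by
  have hl : 0 < 2 * r - b - a := by linarith
  have hmem : ∀ t : unitInterval, a + t * (2 * r - b - a) ∈ Icc a (2 * r - b) := fun t =>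
    ⟨by nlinarith [t.2.1], by nlinarith [t.2.2]⟩
  refine ⟨fun t => turnParam a b r (a + t * (2 * r - b - a)),
    (continuous_turnParam a b r).comp (by fun_prop), ?_, ?_, ?_, ?_⟩
  · intro s t h
    have := injOn_turnParam hab (hmem s) (hmem t) h
    exact Subtype.ext (mul_right_cancel₀ hl.ne' (add_left_cancel this))
  · rw [← image_turnParam (hab.le.trans hbr) hbr]
    refine subset_antisymm (range_subset_iff.2 fun t => mem_image_of_mem _ (hmem t)) ?_
    rintro _ ⟨x, hx, rfl⟩
    refine ⟨⟨(x - a) / (2 * r - b - a), div_nonneg (by linarith [hx.1]) hl.le,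
      (div_le_one hl).2 (by linarith [hx.2])⟩, ?_⟩
    change turnParam a b r (a + (x - a) / (2 * r - b - a) * (2 * r - b - a)) = _
    rw [div_mul_cancel₀ _ hl.ne', add_sub_cancel]
  · simp only [Icc.coe_zero, zero_mul, add_zero]
    rw [turnParam_of_le (by linarith)]
    simp
  · simp only [Icc.coe_one, one_mul]
    rw [turnParam_of_ge (by linarith)]
    simp

theorem IsArc.isCompact {A : Set Plane} {x y : Plane} (h : IsArc A x y) : IsCompact A := by
  obtain ⟨γ, hγ, -, rfl, -⟩ := h
  exact isCompact_range hγ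

theorem IsArc.image {A : Set Plane} {x y : Plane} (h : IsArc A x y) (e : Plane ≃ₜ Plane) :
    IsArc (e '' A) (e x) (e y) := by
  obtain ⟨γ, hγ, hi, rfl, rfl, rfl⟩ := h
  exact ⟨e ∘ γ, e.continuous.comp hγ, e.injective.comp hi, range_comp _ _, rfl, rfl⟩

theorem ProperlyCrossAt.symm {A B : Set Plane} {p : Plane} (h : ProperlyCrossAt A B p) :
    ProperlyCrossAt B A p := by
  obtain ⟨e, hp, h0, h⟩ := h
  refine ⟨e.trans (Homeomorph.prodComm ℝ ℝ).toOpenPartialHomeomorph, by simpa using hp, ?_, ?_⟩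
  · simp [h0]
  · intro q hq
    have hq' : q ∈ e.source := by simpa using hq
    simpa using (h q hq').symm

theorem ProperlyCrossAt.image {A B : Set Plane} {p : Plane} (h : ProperlyCrossAt A B p)
    (g : Plane ≃ₜ Plane) : ProperlyCrossAt (g '' A) (g '' B) (g p) := by
  obtain ⟨e, hp, h0, h⟩ := h
  refine ⟨g.symm.toOpenPartialHomeomorph.trans e, by simpa using hp, by simpa using h0, ?_⟩
  intro q hq
  obtain ⟨q, rfl⟩ := g.surjective q
  have hq' : q ∈ e.source := by simpa using hq
  simpa [g.injective.mem_set_image] using h q hq'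

/-- Below the axis, the defining functions of two circles over the axis with different centres are
coordinates of the plane. -/
noncomputable def circleCoordinates (a b c d : ℝ) (h : a + b ≠ c + d) :
    OpenPartialHomeomorph Plane Plane where
  toFun p := ((p.1 - c) * (p.1 - d) + p.2 ^ 2, (p.1 - a) * (p.1 - b) + p.2 ^ 2)
  invFun u :=
    -- The difference of the two circle functions is affine in `p.1` with slope `a + b - (c + d)`,
    -- which recovers the abscissa; the height is then the negative root.
    ((u.1 - u.2 - (c * d - a * b)) / (a + b - (c + d)),
      -√(u.2 - ((u.1 - u.2 - (c * d - a * b)) / (a + b - (c + d)) - a) *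
        ((u.1 - u.2 - (c * d - a * b)) / (a + b - (c + d)) - b)))
  source := {p | p.2 < 0}
  target := {u | 0 < u.2 - ((u.1 - u.2 - (c * d - a * b)) / (a + b - (c + d)) - a) *
        ((u.1 - u.2 - (c * d - a * b)) / (a + b - (c + d)) - b)}
  map_source' p hp := by
    have hne : a + b - (c + d) ≠ 0 := sub_ne_zero.2 h
    have hx : ((p.1 - c) * (p.1 - d) + p.2 ^ 2 - ((p.1 - a) * (p.1 - b) + p.2 ^ 2) -
        (c * d - a * b)) / (a + b - (c + d)) = p.1 := by
      rw [div_eq_iff hne]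
      ring
    simp only [mem_ofPred_eq] at hp ⊢
    rw [hx]
    nlinarith
  map_target' u hu := by
    simp only [mem_ofPred_eq] at hu ⊢
    exact neg_neg_of_pos (Real.sqrt_pos.2 hu)
  left_inv' p hp := by
    have hne : a + b - (c + d) ≠ 0 := sub_ne_zero.2 h
    have hx : ((p.1 - c) * (p.1 - d) + p.2 ^ 2 - ((p.1 - a) * (p.1 - b) + p.2 ^ 2) -
        (c * d - a * b)) / (a + b - (c + d)) = p.1 := by
      rw [div_eq_iff hne]
      ring
    simp only [mem_ofPred_eq] at hp ⊢
    rw [hx]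
    refine Prod.ext rfl ?_
    change -√((p.1 - a) * (p.1 - b) + p.2 ^ 2 - (p.1 - a) * (p.1 - b)) = p.2
    rw [show (p.1 - a) * (p.1 - b) + p.2 ^ 2 - (p.1 - a) * (p.1 - b) = (-p.2) ^ 2 by ring,
      Real.sqrt_sq (by linarith), neg_neg]
  right_inv' u hu := by
    have hne : a + b - (c + d) ≠ 0 := sub_ne_zero.2 h
    simp only [mem_ofPred_eq] at hu
    have hx := div_mul_cancel₀ (u.1 - u.2 - (c * d - a * b)) hne
    have hy := Real.sq_sqrt hu.le
    generalize hX : (u.1 - u.2 - (c * d - a * b)) / (a + b - (c + d)) = x at *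
    simp only [neg_sq]
    rw [hy]
    refine Prod.ext ?_ ?_
    · change (x - c) * (x - d) + (u.2 - (x - a) * (x - b)) = u.1
      linarith
    · change (x - a) * (x - b) + (u.2 - (x - a) * (x - b)) = u.2
      ring
  open_source := isOpen_lt continuous_snd continuous_const
  open_target := isOpen_lt continuous_const (by fun_prop)
  continuousOn_toFun := by fun_prop
  continuousOn_invFun := by fun_prop

theorem properlyCrossAt_turnArc {a b r c d t : ℝ} (h : b + r ≠ d + t) {p : Plane} (hp : p.2 < 0)
    (h1 : p ∈ turnArc a b r) (h2 : p ∈ turnArc c d t) :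
    ProperlyCrossAt (turnArc a b r) (turnArc c d t) p := by
  have key : ∀ (a b r : ℝ) (q : Plane), q.2 < 0 →
      (q ∈ turnArc a b r ↔ (q.1 - b) * (q.1 - r) + q.2 ^ 2 = 0) := by
    intro a b r q hq
    constructor
    · rintro (h | h)
      · exact absurd h.1 (not_le.2 hq)
      · exact h.2
    · exact fun h => Or.inr ⟨hq.le, h⟩
  exact ⟨circleCoordinates b r d t h, hp, Prod.ext ((key _ _ _ _ hp).1 h2) ((key _ _ _ _ hp).1 h1),
    fun q hq => ⟨key _ _ _ _ hq, key _ _ _ _ hq⟩⟩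

/-- Two circles over the axis with interlaced diameters meet below the axis. -/
theorem exists_mem_circles {a b c d : ℝ} (hac : a < c) (hcb : c < b) (hbd : b < d) :
    ∃ p : Plane, p.2 < 0 ∧ (p.1 - a) * (p.1 - b) + p.2 ^ 2 = 0 ∧
      (p.1 - c) * (p.1 - d) + p.2 ^ 2 = 0 := by
  have hs : 0 < c + d - (a + b) := by linarith
  -- The abscissa of the radical axis of the two circles.
  obtain ⟨x, hx⟩ : ∃ x, x * (c + d - (a + b)) = c * d - a * b := ⟨_, div_mul_cancel₀ _ hs.ne'⟩
  have hcx : c < x := by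
    by_contra! hle
    nlinarith [mul_le_mul_of_nonneg_right hle hs.le, mul_pos (sub_pos.2 hac) (sub_pos.2 hcb)]
  have hxb : x < b := by
    by_contra! hle
    nlinarith [mul_le_mul_of_nonneg_right hle hs.le, mul_pos (sub_pos.2 hcb) (sub_pos.2 hbd)]
  have hpos : 0 < (x - a) * (b - x) := mul_pos (by linarith) (by linarith)
  have hsq := Real.sq_sqrt hpos.le
  refine ⟨(x, -√((x - a) * (b - x))), neg_neg_of_pos (Real.sqrt_pos.2 hpos), ?_, ?_⟩
  · change (x - a) * (x - b) + (-√((x - a) * (b - x))) ^ 2 = 0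
    rw [neg_sq, hsq]
    ring
  · change (x - c) * (x - d) + (-√((x - a) * (b - x))) ^ 2 = 0
    rw [neg_sq, hsq]
    linarith

theorem eq_of_mem_circles {a b c d : ℝ} (h : a + b ≠ c + d) {p q : Plane} (hp : p.2 < 0)
    (hq : q.2 < 0) (hp1 : (p.1 - a) * (p.1 - b) + p.2 ^ 2 = 0)
    (hp2 : (p.1 - c) * (p.1 - d) + p.2 ^ 2 = 0) (hq1 : (q.1 - a) * (q.1 - b) + q.2 ^ 2 = 0)
    (hq2 : (q.1 - c) * (q.1 - d) + q.2 ^ 2 = 0) : p = q :=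
  (circleCoordinates a b c d h).injOn hp hq
    (Prod.ext (hp2.trans hq2.symm) (hp1.trans hq1.symm))

/-- Along `turnArc a b r`, the square root of the displacement from a point `(c, 0)` encircled by
the arc changes sign. -/
theorem sqrt_sign_turnArc {a b r c : ℝ} (hac : a < c) (hbc : b < c) (hcr : c < r) {s : Plane → ℂ}
    (hs : ContinuousOn s (turnArc a b r)) (hs2 : ∀ q ∈ turnArc a b r,
      (s q).re ^ 2 - (s q).im ^ 2 = q.1 - c ∧ 2 * ((s q).re * (s q).im) = q.2) :
    0 < (s (a, 0)).im ↔ ¬ 0 < (s (b, 0)).im := by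
  have ha : ((a, 0) : Plane) ∈ upperSemicircle a r := by simp [upperSemicircle]
  have hr : ((r, 0) : Plane) ∈ upperSemicircle a r := by simp [upperSemicircle]
  have hb : ((b, 0) : Plane) ∈ lowerSemicircle b r := by simp [lowerSemicircle]
  have hr' : ((r, 0) : Plane) ∈ lowerSemicircle b r := by simp [lowerSemicircle]
  have hleft : ∀ x < c, ((x, 0) : Plane) ∈ turnArc a b r →
      (s (x, 0)).re = 0 ∧ (s (x, 0)).im ≠ 0 := by
    intro x hx hm
    obtain ⟨h1, h2⟩ := hs2 _ hm
    simp only at h1 h2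
    have him : (s (x, 0)).im ≠ 0 := fun h => by
      rw [h] at h1
      nlinarith [sq_nonneg (s (x, 0)).re]
    exact ⟨(mul_eq_zero.1 (by linarith : (s (x, 0)).re * (s (x, 0)).im = 0)).resolve_right him, him⟩
  have hright : (s (r, 0)).im = 0 := by
    obtain ⟨h1, h2⟩ := hs2 _ (Or.inl hr)
    simp only at h1 h2
    have hre : (s (r, 0)).re ≠ 0 := fun h => by
      rw [h] at h1
      nlinarith [sq_nonneg (s (r, 0)).im]
    exact (mul_eq_zero.1 (by linarith : (s (r, 0)).re * (s (r, 0)).im = 0)).resolve_left hre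
  have hzero : ∀ q ∈ turnArc a b r, (s q).re = 0 → (s q).im = 0 → False := by
    intro q hq h1 h2
    obtain ⟨h3, h4⟩ := hs2 q hq
    rw [h1, h2] at h3 h4
    have hx : q.1 = c := by linarith
    have hy : q.2 = 0 := by linarith
    rcases hq with hq | hq <;> rcases circle_of_axis hq.2 hy with h | h <;>
      rw [h] at hx <;> simp only at hx <;> linarith
  -- Above the axis `re * im ≥ 0`, so `re + im` vanishes only where `s` does, which is nowhere on
  -- the arc. Below it the same holds for `re - im`. At the left ends `s` is imaginary and at the
  -- turning point real, so comparing signs gives the flip.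
  have hU := pos_iff_pos_of_isPreconnected (isPreconnected_upperSemicircle (hac.trans hcr).le)
    (f := fun q => (s q).re + (s q).im)
    ((Complex.continuous_re.comp_continuousOn (hs.mono subset_union_left)).add
      (Complex.continuous_im.comp_continuousOn (hs.mono subset_union_left)))
    (fun q hq h => by
      have h4 := (hs2 q (Or.inl hq)).2
      have h5 : 0 ≤ q.2 := hq.1
      have h6 : (s q).im = -(s q).re := by linarith
      rw [h6] at h4
      have h7 : (s q).re = 0 := by nlinarith [sq_nonneg (s q).re]
      exact hzero q (Or.inl hq) h7 (by rw [h6, h7, neg_zero])) ha hr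
  have hL := pos_iff_pos_of_isPreconnected (isPreconnected_lowerSemicircle (hbc.trans hcr).le)
    (f := fun q => (s q).re - (s q).im)
    ((Complex.continuous_re.comp_continuousOn (hs.mono subset_union_right)).sub
      (Complex.continuous_im.comp_continuousOn (hs.mono subset_union_right)))
    (fun q hq h => by
      have h4 := (hs2 q (Or.inr hq)).2
      have h5 : q.2 ≤ 0 := hq.1
      have h6 : (s q).im = (s q).re := by linarith
      rw [h6] at h4
      have h7 : (s q).re = 0 := by nlinarith [sq_nonneg (s q).re]
      exact hzero q (Or.inr hq) h7 (by rw [h6, h7])) hb hr'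
  obtain ⟨ha0, -⟩ := hleft a hac (Or.inl ha)
  obtain ⟨hb0, hb1⟩ := hleft b hbc (Or.inr hb)
  simp only [ha0, hb0, hright, zero_add, add_zero, sub_zero, zero_sub] at hU hL
  rw [hU, ← hL, not_lt, Left.neg_pos_iff]
  exact ⟨le_of_lt, fun h => lt_of_le_of_ne h hb1⟩

/-! ### Drawings -/

/-- Each step negates `σ`. For a closed walk the ends agree trivially, which forces even length. -/
theorem SimpleGraph.Walk.iff_iff_even_length {V : Type*} {G : SimpleGraph V} (σ : V → Prop)
    {u v : V} (w : G.Walk u v) (h : ∀ x y, s(x, y) ∈ w.edges → (σ x ↔ ¬ σ y)) :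
    (σ u ↔ σ v) ↔ Even w.length := by
  induction w with
  | nil => simp
  | @cons u x v hux w ih =>
    have h1 := h u x (by simp)
    have h2 := ih fun y z hyz => h y z (by simp [hyz])
    rw [SimpleGraph.Walk.length_cons, Nat.even_add_one, ← h2]
    tauto

namespace Drawing

variable {V : Type*}

theorem arcInterior_map (D : Drawing V) (h : Plane ≃ₜ Plane) (e : Sym2 V) :
    (D.map h).arcInterior e = h '' D.arcInterior e := by
  have : (D.map h).point '' {v | v ∈ e} = h '' (D.point '' {v | v ∈ e}) :=
    (image_image h D.point _).symm
  rw [arcInterior, arcInterior, image_sdiff h.injective, this]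
  rfl

theorem curve_map (D : Drawing V) (h : Plane ≃ₜ Plane) {v : V} (c : D.graph.Walk v v) :
    (D.map h).curve (v := v) c = h '' D.curve c := by
  simp only [curve, image_iUnion]
  rfl

theorem IsCompleteSimple.map {D : Drawing V} (hD : D.IsCompleteSimple) (h : Plane ≃ₜ Plane) :
    (D.map h).IsCompleteSimple where
  point_injective := h.injective.comp hD.point_injective
  isArc u v huv := (hD.isArc u v huv).image h
  mem_of_point_mem e he w hw := hD.mem_of_point_mem e he w (h.injective.mem_set_image.1 hw)
  properlyCross e he f hf hef p hp := by
    rw [arcInterior_map, arcInterior_map, ← image_inter h.injective] at hp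
    obtain ⟨p, hp, rfl⟩ := hp
    exact (hD.properlyCross e he f hf hef p hp).image h
  complete := hD.complete
  simple e he f hf hef := by
    change (h '' D.arc e ∩ h '' D.arc f).Subsingleton
    rw [← image_inter h.injective]
    exact (hD.simple e he f hf hef).image h

theorem CrossesIffNested.map {n : ℕ} {D : Drawing (Fin n)} (hD : D.CrossesIffNested)
    (h : Plane ≃ₜ Plane) : (D.map h).CrossesIffNested := by
  intro i j k l hij hkl hne
  rw [arcInterior_map, arcInterior_map, ← image_inter h.injective, image_nonempty]
  exact hD i j k l hij hkl hne

theorem isCompact_curve {D : Drawing V} (hD : D.IsTopologicalGraph) {v : V}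
    (c : D.graph.Walk v v) : IsCompact (D.curve c) := by
  refine (List.finite_toSet c.edges).isCompact_biUnion fun e he => ?_
  have he' := c.edges_subset_edgeSet he
  induction e with
  | h x y => exact (hD.isArc x y he').isCompact

theorem IsOddFace.map {D : Drawing V} (h : Plane ≃ₜ Plane) {F : Set Plane}
    (hF : (D.map h).IsOddFace F) :
    ∃ (v : V) (c : D.graph.Walk v v), Odd c.length ∧ F = h '' faceInside (D.curve c) := by
  obtain ⟨k, hk, v, c, -, rfl, -, rfl⟩ := hF
  exact ⟨v, c, hk, by rw [← faceInside_image]; exact congrArg faceInside (curve_map D h c)⟩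

end Drawing

/-! ### The standard twisted drawing -/

section Twisted

variable {n : ℕ}

theorem standardTwisted_arc {i j : Fin n} (hij : i < j) :
    (standardTwisted n).arc s(i, j) = turnArc ((i : ℕ) + 1) ((j : ℕ) + 1) (twistedTurn i j) := by
  simp [standardTwisted, turnArc, inf_eq_left.2 hij.le, sup_eq_right.2 hij.le]

theorem Fin.cast_add_one_le_cast {i j : Fin n} (hij : i < j) :
    ((i : ℕ) : ℝ) + 1 ≤ ((j : ℕ) : ℝ) := by
  exact_mod_cast Nat.succ_le_of_lt (Fin.lt_def.1 hij)

theorem Fin.cast_add_one_le (i : Fin n) : ((i : ℕ) : ℝ) + 1 ≤ n := by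
  exact_mod_cast Nat.succ_le_of_lt i.2

/-- Indices are at most `n - 1`, so the turn is at least `2 * (n + 1)`. -/
theorem lt_twistedTurn (i j : Fin n) : (n : ℝ) + 1 < twistedTurn i j := by
  have hi := Fin.cast_add_one_le i
  have hj := Fin.cast_add_one_le j
  have hn : (0 : ℝ) ≤ n := n.cast_nonneg
  unfold twistedTurn
  nlinarith [mul_le_mul_of_nonneg_left hi hn]

/-- One step in the first index costs `n`, more than the second index can make up. -/
theorem twistedTurn_lt {i j k l : Fin n} (h : i < k ∨ i = k ∧ j < l) :
    twistedTurn k l < twistedTurn i j := by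
  have hj := Fin.cast_add_one_le j
  have hn : (0 : ℝ) ≤ n := n.cast_nonneg
  have hl : (0 : ℝ) ≤ (l : ℕ) := Nat.cast_nonneg _
  unfold twistedTurn
  rcases h with h | ⟨rfl, h⟩
  · nlinarith [mul_le_mul_of_nonneg_left (Fin.cast_add_one_le_cast h) hn]
  · linarith [Fin.cast_add_one_le_cast h]

theorem Fin.cast_inj_real {i j : Fin n} (h : ((i : ℕ) : ℝ) = (j : ℕ)) : i = j :=
  Fin.ext (by exact_mod_cast h)

theorem standardTwisted_point_injective : Function.Injective (standardTwisted n).point := by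
  intro i j h
  have h1 : ((i : ℕ) : ℝ) + 1 = (j : ℕ) + 1 := congrArg Prod.fst h
  exact Fin.cast_inj_real (by linarith)

theorem standardTwisted_mem_of_point_mem {i j k : Fin n} (hij : i < j)
    (h : (standardTwisted n).point k ∈ (standardTwisted n).arc s(i, j)) : k = i ∨ k = j := by
  rw [standardTwisted_arc hij] at h
  have hr := lt_twistedTurn i j
  have hk := Fin.cast_add_one_le k
  rcases h with h | h <;> rcases circle_of_axis h.2 rfl with h | h <;>
    have h1 : ((k : ℕ) : ℝ) + 1 = _ := congrArg Prod.fst h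
  · exact Or.inl (Fin.cast_inj_real (by simpa using h1))
  · simp only at h1; linarith
  · exact Or.inr (Fin.cast_inj_real (by simpa using h1))
  · simp only at h1; linarith

/-- The common points of two edges of the standard twisted drawing. -/
theorem standardTwisted_inter {i j k l : Fin n} (hij : i < j) (hkl : k < l)
    (h : i < k ∨ i = k ∧ j < l) {p : Plane} (h1 : p ∈ (standardTwisted n).arc s(i, j))
    (h2 : p ∈ (standardTwisted n).arc s(k, l)) :
    (∃ v, p = (standardTwisted n).point v ∧ v ∈ s(i, j) ∧ v ∈ s(k, l)) ∨
      i < k ∧ l < j ∧ p.2 < 0 ∧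
        (p.1 - ((j : ℕ) + 1)) * (p.1 - twistedTurn i j) + p.2 ^ 2 = 0 ∧
        (p.1 - ((l : ℕ) + 1)) * (p.1 - twistedTurn k l) + p.2 ^ 2 = 0 := by
  rw [standardTwisted_arc hij] at h1
  rw [standardTwisted_arc hkl] at h2
  have hr := lt_twistedTurn i j
  have ht := lt_twistedTurn k l
  have hrt := twistedTurn_lt h
  have hi := Fin.cast_add_one_le i
  have hj := Fin.cast_add_one_le j
  have hk := Fin.cast_add_one_le k
  have hl := Fin.cast_add_one_le l
  have hik : i ≤ k := h.elim le_of_lt fun h => h.1.le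
  have hik' : ((i : ℕ) : ℝ) ≤ (k : ℕ) := by exact_mod_cast hik
  have hij' := Fin.cast_add_one_le_cast hij
  have hkl' := Fin.cast_add_one_le_cast hkl
  rcases h1 with h1 | h1 <;> rcases h2 with h2 | h2
  -- Upper halves have nested diameters. Opposite halves meet only on the axis, hence only if `j =
  -- k`. Lower halves are nested if `j ≤ l` and interlaced if `l < j`.
  · obtain ⟨h3, h4⟩ := eq_of_circle_of_circle (by linarith) (by linarith) hrt h1.2 h2.2
    obtain rfl : i = k := Fin.cast_inj_real (by linarith)
    exact Or.inl ⟨i, h4, by simp, by simp⟩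
  · have h0 : p.2 = 0 := le_antisymm h2.1 h1.1
    rcases circle_of_axis h1.2 h0 with h3 | h3 <;> rcases circle_of_axis h2.2 h0 with h4 | h4 <;>
      have h5 := congrArg Prod.fst (h3.symm.trans h4) <;> simp only at h5 <;> linarith
  · have h0 : p.2 = 0 := le_antisymm h1.1 h2.1
    rcases circle_of_axis h1.2 h0 with h3 | h3 <;> rcases circle_of_axis h2.2 h0 with h4 | h4 <;>
      have h5 := congrArg Prod.fst (h3.symm.trans h4) <;> simp only at h5
    · obtain rfl : j = k := Fin.cast_inj_real (by linarith)
      exact Or.inl ⟨j, h3, by simp, by simp⟩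
    all_goals linarith
  · rcases le_or_gt j l with hjl | hlj
    · have hjl' : ((j : ℕ) : ℝ) ≤ (l : ℕ) := by exact_mod_cast hjl
      obtain ⟨h3, h4⟩ := eq_of_circle_of_circle (by linarith) (by linarith) hrt h1.2 h2.2
      obtain rfl : j = l := Fin.cast_inj_real (by linarith)
      exact Or.inl ⟨j, h4, by simp, by simp⟩
    · have hlj' := Fin.cast_add_one_le_cast hlj
      refine Or.inr ⟨h.resolve_right fun h => absurd h.2 (not_lt.2 hlj.le), hlj, ?_, h1.2, h2.2⟩
      refine lt_of_le_of_ne h1.1 fun h0 => ?_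
      rcases circle_of_axis h1.2 h0 with h3 | h3 <;> rcases circle_of_axis h2.2 h0 with h4 | h4 <;>
        have h5 := congrArg Prod.fst (h3.symm.trans h4) <;> simp only at h5 <;> linarith

theorem twisted_centre_ne {i j k l : Fin n} (hik : i < k) (hlj : l < j) :
    (((j : ℕ) : ℝ) + 1) + twistedTurn i j ≠ (((l : ℕ) : ℝ) + 1) + twistedTurn k l := by
  have h1 := twistedTurn_lt (j := j) (l := l) (Or.inl hik)
  have h2 := Fin.cast_add_one_le_cast hlj
  linarith

theorem standardTwisted_inter_subsingleton {i j k l : Fin n} (hij : i < j) (hkl : k < l)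
    (h : i < k ∨ i = k ∧ j < l) :
    ((standardTwisted n).arc s(i, j) ∩ (standardTwisted n).arc s(k, l)).Subsingleton := by
  rintro p ⟨hp1, hp2⟩ q ⟨hq1, hq2⟩
  -- Distinct edges share at most one vertex, strictly nested ones share none, and a crossing below
  -- the axis is unique.
  rcases standardTwisted_inter hij hkl h hp1 hp2 with ⟨v, rfl, hv1, hv2⟩ | hp <;>
    rcases standardTwisted_inter hij hkl h hq1 hq2 with ⟨w, rfl, hw1, hw2⟩ | hq
  · rw [show v = w by rw [Sym2.mem_iff] at *; omega]
  · rw [Sym2.mem_iff] at *; omega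
  · rw [Sym2.mem_iff] at *; omega
  · exact eq_of_mem_circles (twisted_centre_ne hp.1 hp.2.1) hp.2.2.1 hq.2.2.1 hp.2.2.2.1
      hp.2.2.2.2 hq.2.2.2.1 hq.2.2.2.2

theorem standardTwisted_interior_inter {i j k l : Fin n} (hij : i < j) (hkl : k < l)
    (h : i < k ∨ i = k ∧ j < l) {p : Plane} (h1 : p ∈ (standardTwisted n).arcInterior s(i, j))
    (h2 : p ∈ (standardTwisted n).arcInterior s(k, l)) : i < k ∧ l < j ∧
      ProperlyCrossAt ((standardTwisted n).arc s(i, j)) ((standardTwisted n).arc s(k, l)) p := by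
  rcases standardTwisted_inter hij hkl h h1.1 h2.1 with ⟨v, rfl, hv, -⟩ | ⟨hik, hlj, hp, -, -⟩
  · exact absurd (mem_image_of_mem _ hv) h1.2
  · have h3 := h1.1
    have h4 := h2.1
    rw [standardTwisted_arc hij] at h3 ⊢
    rw [standardTwisted_arc hkl] at h4 ⊢
    exact ⟨hik, hlj, properlyCrossAt_turnArc (twisted_centre_ne hik hlj) hp h3 h4⟩

theorem standardTwisted_interior_inter_nonempty {i j k l : Fin n} (hik : i < k) (hkl : k < l)
    (hlj : l < j) : ((standardTwisted n).arcInterior s(i, j) ∩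
      (standardTwisted n).arcInterior s(k, l)).Nonempty := by
  have hj := Fin.cast_add_one_le j
  obtain ⟨p, hp, hp1, hp2⟩ := exists_mem_circles
    (a := ((l : ℕ) : ℝ) + 1) (b := twistedTurn k l) (c := ((j : ℕ) : ℝ) + 1) (d := twistedTurn i j)
    (by linarith [Fin.cast_add_one_le_cast hlj]) (by linarith [lt_twistedTurn k l])
    (twistedTurn_lt (Or.inl hik))
  have hv : ∀ e : Sym2 (Fin n), p ∉ (standardTwisted n).point '' {v | v ∈ e} := by
    rintro e ⟨v, -, rfl⟩
    exact lt_irrefl _ hp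
  refine ⟨p, ⟨?_, hv _⟩, ⟨?_, hv _⟩⟩
  · rw [standardTwisted_arc (hik.trans (hkl.trans hlj))]
    exact Or.inr ⟨hp.le, hp2⟩
  · rw [standardTwisted_arc hkl]
    exact Or.inr ⟨hp.le, hp1⟩

theorem exists_lt_of_mem_edgeSet {e : Sym2 (Fin n)} (he : e ∈ (standardTwisted n).graph.edgeSet) :
    ∃ i j, i < j ∧ e = s(i, j) := by
  induction e with
  | h i j =>
    rcases lt_or_gt_of_ne ((SimpleGraph.mem_edgeSet _).1 he).ne with h | h
    · exact ⟨i, j, h, rfl⟩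
    · exact ⟨j, i, h, Sym2.eq_swap⟩

theorem lex_or_lex {i j k l : Fin n} (hne : s(i, j) ≠ s(k, l)) :
    (i < k ∨ i = k ∧ j < l) ∨ (k < i ∨ k = i ∧ l < j) := by
  have : ¬ (i = k ∧ j = l) := by
    rintro ⟨rfl, rfl⟩
    exact hne rfl
  omega

theorem standardTwisted_isArc {i j : Fin n} (hij : i < j) :
    IsArc ((standardTwisted n).arc s(i, j)) ((standardTwisted n).point i)
      ((standardTwisted n).point j) := by
  rw [standardTwisted_arc hij]
  have := Fin.cast_add_one_le_cast hij
  exact isArc_turnArc (by linarith) (by linarith [Fin.cast_add_one_le j, lt_twistedTurn i j])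

theorem IsArc.symm {A : Set Plane} {x y : Plane} (h : IsArc A x y) : IsArc A y x := by
  obtain ⟨γ, hγ, hi, rfl, rfl, rfl⟩ := h
  refine ⟨γ ∘ unitInterval.symm, hγ.comp unitInterval.continuous_symm,
    hi.comp unitInterval.symm_bijective.injective, ?_, by simp, by simp⟩
  exact unitInterval.symm_bijective.surjective.range_comp γ

theorem standardTwisted_isCompleteSimple (n : ℕ) : (standardTwisted n).IsCompleteSimple where
  point_injective := standardTwisted_point_injective
  isArc u v huv := by
    rcases lt_or_gt_of_ne (SimpleGraph.Adj.ne huv) with h | h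
    · exact standardTwisted_isArc h
    · rw [Sym2.eq_swap]
      exact (standardTwisted_isArc h).symm
  mem_of_point_mem e he w hw := by
    obtain ⟨i, j, hij, rfl⟩ := exists_lt_of_mem_edgeSet he
    exact Sym2.mem_iff.2 (standardTwisted_mem_of_point_mem hij hw)
  properlyCross e he f hf hef p hp := by
    obtain ⟨i, j, hij, rfl⟩ := exists_lt_of_mem_edgeSet he
    obtain ⟨k, l, hkl, rfl⟩ := exists_lt_of_mem_edgeSet hf
    rcases lex_or_lex hef with h | h
    · exact (standardTwisted_interior_inter hij hkl h hp.1 hp.2).2.2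
    · exact (standardTwisted_interior_inter hkl hij h hp.2 hp.1).2.2.symm
  complete := rfl
  simple e he f hf hef := by
    obtain ⟨i, j, hij, rfl⟩ := exists_lt_of_mem_edgeSet he
    obtain ⟨k, l, hkl, rfl⟩ := exists_lt_of_mem_edgeSet hf
    rcases lex_or_lex hef with h | h
    · exact standardTwisted_inter_subsingleton hij hkl h
    · rw [inter_comm]
      exact standardTwisted_inter_subsingleton hkl hij h

theorem standardTwisted_crossesIffNested (n : ℕ) : (standardTwisted n).CrossesIffNested := by
  intro i j k l hij hkl hne
  constructor
  · rintro ⟨p, hp1, hp2⟩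
    rcases lex_or_lex hne with h | h
    · have := standardTwisted_interior_inter hij hkl h hp1 hp2
      exact Or.inl ⟨this.1, this.2.1⟩
    · have := standardTwisted_interior_inter hkl hij h hp2 hp1
      exact Or.inr ⟨this.1, this.2.1⟩
  · rintro (⟨h1, h2⟩ | ⟨h1, h2⟩)
    · exact standardTwisted_interior_inter_nonempty h1 hkl h2
    · rw [inter_comm]
      exact standardTwisted_interior_inter_nonempty h1 hij h2

/-- The point on the axis between the vertices and the turning points of the edges. -/
def twistedCentre (n : ℕ) : Plane := ((n : ℝ) + 1, 0)

theorem twistedCentre_notMem_arc {e : Sym2 (Fin n)}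
    (he : e ∈ (standardTwisted n).graph.edgeSet) :
    twistedCentre n ∉ (standardTwisted n).arc e := by
  obtain ⟨i, j, hij, rfl⟩ := exists_lt_of_mem_edgeSet he
  rw [standardTwisted_arc hij]
  have hi := Fin.cast_add_one_le i
  have hj := Fin.cast_add_one_le j
  have hr := lt_twistedTurn i j
  rintro (h | h) <;> rcases circle_of_axis h.2 rfl with h | h <;>
    have h1 : (n : ℝ) + 1 = _ := congrArg Prod.fst h <;> simp only at h1 <;> linarith

theorem twistedCentre_mem_faceInside {v : Fin n} (c : (standardTwisted n).graph.Walk v v)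
    (hc : Odd c.length) : twistedCentre n ∈ faceInside ((standardTwisted n).curve c) := by
  by_contra hF
  have hK := Drawing.isCompact_curve (standardTwisted_isCompleteSimple n).toIsTopologicalGraph c
  have hp : twistedCentre n ∉ (standardTwisted n).curve c := by
    simp only [Drawing.curve, mem_iUnion, not_exists]
    exact fun e he => twistedCentre_notMem_arc (c.edges_subset_edgeSet he)
  obtain ⟨s, hs, hs2⟩ := exists_sqrt_of_notMem_faceInside hK hp hF
  have key : ∀ i j, i < j → s(i, j) ∈ c.edges → (0 < (s ((standardTwisted n).point i)).im ↔
      ¬ 0 < (s ((standardTwisted n).point j)).im) := by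
    intro i j hij he
    have hsub : turnArc ((i : ℕ) + 1) ((j : ℕ) + 1) (twistedTurn i j) ⊆
        (standardTwisted n).curve c := by
      rw [← standardTwisted_arc hij]
      exact subset_biUnion_of_mem (u := fun e => (standardTwisted n).arc e) he
    refine sqrt_sign_turnArc (by linarith [Fin.cast_add_one_le i])
      (by linarith [Fin.cast_add_one_le j]) (lt_twistedTurn i j) (hs.mono hsub) fun q hq => ?_
    simpa [twistedCentre] using hs2 q (hsub hq)
  -- The sign of the imaginary part 2-colours the vertices of the walk, alternating along its edges.
  have heven := (SimpleGraph.Walk.iff_iff_even_length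
    (fun i => 0 < (s ((standardTwisted n).point i)).im) c ?_).1 Iff.rfl
  · exact Nat.not_even_iff_odd.2 hc heven
  · intro i j he
    rcases lt_or_gt_of_ne (c.adj_of_mem_edges he).ne with h | h
    · exact key i j h he
    · have := key j i h (by rwa [Sym2.eq_swap])
      tauto

end Twisted

/-! ### Enlarging a neighbourhood -/

theorem exists_homeomorph_stretch (c : ℝ) {δ R η : ℝ} (hδ : 0 < δ) (hR : 0 < R) (hη : 0 < η)
    (hη' : η < 1 / 2) : ∃ f : ℝ ≃ₜ ℝ, (∀ x ∈ Metric.closedBall c R, f x ∈ Icc (0 : ℝ) 1) ∧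
      Icc η (1 - η) ⊆ f '' Metric.closedBall c δ := by
  set A : ℝ := (1 / 2 - η) / δ with hA
  set B : ℝ := η / R with hB
  have hAδ : A * δ = 1 / 2 - η := div_mul_cancel₀ _ hδ.ne'
  have hBR : B * R = η := div_mul_cancel₀ _ hR.ne'
  have hApos : 0 < A := div_pos (by linarith) hδ
  have hBpos : 0 < B := div_pos hη hR
  -- The clamped term stretches the `δ`-ball to length `1 - 2 * η`; the small slope `B` keeps `f`
  -- bijective and adds at most `η` in absolute value on the `R`-ball.
  let f : ℝ → ℝ := fun x => 1 / 2 + A * max (-δ) (min δ (x - c)) + B * (x - c)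
  have hf : Continuous f := by fun_prop
  have hclamp : ∀ x : ℝ, -δ ≤ max (-δ) (min δ x) ∧ max (-δ) (min δ x) ≤ δ := fun x =>
    ⟨le_max_left _ _, max_le (by linarith) (min_le_left _ _)⟩
  have hlow : ∀ x, η + B * (x - c) ≤ f x := fun x => by
    have := mul_le_mul_of_nonneg_left (hclamp (x - c)).1 hApos.le
    simp only [f]
    linarith
  have hupp : ∀ x, f x ≤ 1 - η + B * (x - c) := fun x => by
    have := mul_le_mul_of_nonneg_left (hclamp (x - c)).2 hApos.le
    simp only [f]
    linarith
  have hmono : StrictMono f := by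
    intro x y hxy
    have h1 : max (-δ) (min δ (x - c)) ≤ max (-δ) (min δ (y - c)) := by gcongr
    have h2 := mul_le_mul_of_nonneg_left h1 hApos.le
    have h3 := mul_lt_mul_of_pos_left hxy hBpos
    simp only [f]
    linarith
  have hsurj : Function.Surjective f := by
    intro y
    have h1 : f (c + (y - 1) / B) ≤ y := by
      have := hupp (c + (y - 1) / B)
      rw [add_sub_cancel_left, mul_div_cancel₀ _ hBpos.ne'] at this
      linarith
    have h2 : y ≤ f (c + y / B) := by
      have := hlow (c + y / B)
      rw [add_sub_cancel_left, mul_div_cancel₀ _ hBpos.ne'] at this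
      linarith
    exact mem_range_of_exists_le_of_exists_ge hf ⟨_, h1⟩ ⟨_, h2⟩
  refine ⟨(hmono.orderIsoOfSurjective f hsurj).toHomeomorph, fun x hx => ?_, ?_⟩
  · change f x ∈ Icc (0 : ℝ) 1
    rw [Real.closedBall_eq_Icc] at hx
    have h1 := mul_le_mul_of_nonneg_left (show x - c ≤ R by linarith [hx.2]) hBpos.le
    have h2 := mul_le_mul_of_nonneg_left (show -R ≤ x - c by linarith [hx.1]) hBpos.le
    exact ⟨by linarith [hlow x], by linarith [hupp x]⟩
  · change Icc η (1 - η) ⊆ f '' _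
    rw [Real.closedBall_eq_Icc]
    refine (Icc_subset_Icc ?_ ?_).trans (intermediate_value_Icc (by linarith) hf.continuousOn)
    · have : f (c - δ) = 1 / 2 + A * -δ + B * (c - δ - c) := by
        simp [f, sub_sub_cancel_left, min_eq_right (show -δ ≤ δ by linarith)]
      rw [this]
      linarith [mul_pos hBpos hδ]
    · have : f (c + δ) = 1 / 2 + A * δ + B * (c + δ - c) := by
        simp [f, add_sub_cancel_left, max_eq_right (show -δ ≤ δ by linarith)]
      rw [this]
      linarith [mul_pos hBpos hδ]

/-- Balls of the product metric are squares, so stretching each coordinate suffices. -/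
theorem exists_homeomorph_stretch_plane (p : Plane) {δ R η : ℝ} (hδ : 0 < δ) (hR : 0 < R)
    (hη : 0 < η) (hη' : η < 1 / 2) : ∃ h : Plane ≃ₜ Plane,
      (∀ q ∈ Metric.closedBall p R, h q ∈ unitSquare) ∧
        Icc η (1 - η) ×ˢ Icc η (1 - η) ⊆ h '' Metric.closedBall p δ := by
  obtain ⟨f, hf, hf'⟩ := exists_homeomorph_stretch p.1 hδ hR hη hη'
  obtain ⟨g, hg, hg'⟩ := exists_homeomorph_stretch p.2 hδ hR hη hη'
  have hball : ∀ ρ, Metric.closedBall p ρ = Metric.closedBall p.1 ρ ×ˢ Metric.closedBall p.2 ρ :=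
    fun ρ => (closedBall_prod_same p.1 p.2 ρ).symm
  refine ⟨f.prodCongr g, fun q hq => ?_, ?_⟩
  · rw [hball] at hq
    exact ⟨hf _ hq.1, hg _ hq.2⟩
  · rw [hball, Homeomorph.coe_prodCongr, prodMap_image_prod]
    exact prod_mono hf' hg'

theorem ofReal_le_volume_of_subset {ε η : ℝ} (hη' : η < 1 / 2) (hηε : 4 * η ≤ ε)
    {F : Set Plane} (hF : Icc η (1 - η) ×ˢ Icc η (1 - η) ⊆ F) :
    ENNReal.ofReal (1 - ε) ≤ volume F := by
  refine le_trans ?_ (measure_mono hF)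
  rw [Measure.volume_eq_prod, Measure.prod_prod, Real.volume_Icc,
    ← ENNReal.ofReal_mul (by linarith)]
  -- `(1 - 2 * η) ^ 2 ≥ 1 - 4 * η ≥ 1 - ε`.
  exact ENNReal.ofReal_le_ofReal (by nlinarith [sq_nonneg η])

/-- There are finitely many arcs, all compact and missing the centre, so the radii can be chosen
independently of the face. -/
theorem exists_standardTwisted_box (n : ℕ) : ∃ δ R : ℝ, 0 < δ ∧ 0 < R ∧
    (∀ e ∈ (standardTwisted n).graph.edgeSet,
      Metric.closedBall (twistedCentre n) δ ⊆ ((standardTwisted n).arc e)ᶜ) ∧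
    (standardTwisted n).DrawnIn (Metric.closedBall (twistedCentre n) R) := by
  have hK : IsCompact (⋃ e ∈ (standardTwisted n).graph.edgeSet, (standardTwisted n).arc e) := by
    refine (toFinite _).isCompact_biUnion fun e he => ?_
    obtain ⟨i, j, hij, rfl⟩ := exists_lt_of_mem_edgeSet he
    exact (standardTwisted_isArc hij).isCompact
  obtain ⟨δ, hδ, hball⟩ := Metric.nhds_basis_closedBall.mem_iff.1
    (hK.isClosed.isOpen_compl.mem_nhds (x := twistedCentre n)
      (by simpa using fun e he => twistedCentre_notMem_arc he))
  obtain ⟨R, hR, hsub⟩ := (hK.isBounded.union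
    (finite_range (standardTwisted n).point).isBounded).subset_closedBall_lt 0 (twistedCentre n)
  refine ⟨δ, R, hδ, hR, fun e he => hball.trans (compl_subset_compl.2 ?_), fun v => ?_,
    fun e he => ?_⟩
  · exact subset_biUnion_of_mem (u := fun e => (standardTwisted n).arc e) he
  · exact hsub (Or.inr (mem_range_self v))
  · exact ((subset_biUnion_of_mem (u := fun e => (standardTwisted n).arc e) he).trans
      subset_union_left).trans hsub

theorem mainTheorem3 (n : ℕ) :
    (∀ D : Drawing (Fin n), IsCompleteTwisted D →
      D.IsCompleteSimple ∧ D.CrossesIffNested ∧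
        ∃ p : Plane, ∀ F : Set Plane, D.IsOddFace F → p ∈ interior F) ∧
    ∀ ε : ℝ, 0 < ε →
      ∃ D : Drawing (Fin n), IsCompleteTwisted D ∧ D.DrawnIn unitSquare ∧
        ∀ F : Set Plane, D.IsOddFace F → ENNReal.ofReal (1 - ε) ≤ volume F := by
  constructor
  · rintro D ⟨h, rfl⟩
    refine ⟨(standardTwisted_isCompleteSimple n).map h,
      (standardTwisted_crossesIffNested n).map h, h (twistedCentre n), fun F hF => ?_⟩
    obtain ⟨v, c, hc, rfl⟩ := hF.map h
    have hopen := isOpen_faceInside (Drawing.isCompact_curve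
      (standardTwisted_isCompleteSimple n).toIsTopologicalGraph c).isClosed
    rw [(h.isOpenMap _ hopen).interior_eq]
    exact mem_image_of_mem h (twistedCentre_mem_faceInside c hc)
  · intro ε hε
    obtain ⟨δ, R, hδ, hR, hball, hin⟩ := exists_standardTwisted_box n
    -- `ε / 4` serves the area bound; `1 / 4` keeps the margin below `1 / 2` when `ε` is large.
    have hη : 0 < min (ε / 4) (1 / 4) := lt_min (by positivity) (by norm_num)
    have hη' : min (ε / 4) (1 / 4) < 1 / 2 := (min_le_right _ _).trans_lt (by norm_num)
    obtain ⟨h, hsq, hbig⟩ := exists_homeomorph_stretch_plane (twistedCentre n) hδ hR hη hη'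
    refine ⟨(standardTwisted n).map h, ⟨h, rfl⟩, ⟨fun v => hsq _ (hin.1 v), fun e he => ?_⟩,
      fun F hF => ?_⟩
    · rintro _ ⟨q, hq, rfl⟩
      exact hsq q (hin.2 e he hq)
    · obtain ⟨v, c, hc, rfl⟩ := hF.map h
      refine ofReal_le_volume_of_subset hη' (by linarith [min_le_left (ε / 4) (1 / 4)])
        (hbig.trans (image_mono ?_))
      refine subset_faceInside_of_isPreconnected (convex_closedBall _ _).isPreconnected ?_
        (Metric.mem_closedBall_self hδ.le) (twistedCentre_mem_faceInside c hc)
      intro q hq hqc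
      obtain ⟨e, he, hqe⟩ := mem_iUnion₂.1 hqc
      exact hball e (c.edges_subset_edgeSet he) hq hqe
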